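/- Let $\mathbf G$ be a connected (simple, undirected, finite or infinite) graph with a base vertex $*$. For $n\ge 0$ let $\mathbf J_n$ be the line graph with vertices $0,1,\dots,n$ and edges $k\sim k+1$. A graph map sends every edge to an edge or to a single vertex. A loop of length $n$ in $\mathbf G^*$ is a graph map $\Phi\colon \mathbf J_n\to\mathbf G$ with $\Phi(0)=\Phi(n)=*$. Two loops $\Phi,\Psi$ of the same length $n$ are homotopic if for some $k\ge 0$ there is a graph map $F\colon \mathbf J_n\boxdot\mathbf J_k\to\mathbf G$ (Cartesian product) with $F(\cdot,0)=\Phi$, $F(\cdot,k)=\Psi$ and $F(0,t)=F(n,t)=*$ for all $t$. A stabilization of a loop is obtained by keeping it constantly equal to $*$ for finitely many additional steps at its end. Two loops are $S$-homotopic if they have homotopic stabilizations of the same length. The A-theory fundamental group $\pi_1(\mathbf G^*)$ is the group of $S$-homotopy classes of loops under concatenation. Let $G$ be the double digraph of $\mathbf G$, i.e. $v\to w$ in $G$ if and only if $v\sim w$ in $\mathbf G$. Let $\mathcal A_p$ be the free abelian group on the sequences $e_{i_0\dots i_p}$ of vertices with $i_k\to i_{k+1}$ for all $k$, let $\partial e_{i_0\dots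 i_p}=\sum_{q=0}^{p}(-1)^q e_{i_0\dots\widehat{i_q}\dots i_p}$ for $p\ge 1$, where $e_{j_0\dots j_{p-1}}$ is set to $0$ whenever $j_k=j_{k+1}$ for some $k$, and let $\partial=0$ on $\mathcal A_0$. Put $\Omega_0=\mathcal A_0$ and $\Omega_p=\{v\in\mathcal A_p:\partial v\in\mathcal A_{p-1}\}$ for $p\ge1$. The homology of $\mathbf G$ is the path homology of $G$, $H_p(\mathbf G,\mathbb Z)=\ker(\partial|_{\Omega_p})/\partial(\Omega_{p+1})$. Then there is an isomorphism of groups $$\pi_1(\mathbf G^*)/[\pi_1(\mathbf G^*),\pi_1(\mathbf G^*)]\;\cong\; H_1(\mathbf G,\mathbb Z).$$ -/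

import Mathlib

/-! ## Graph maps and homotopies of loops -/

namespace ATheory

open SimpleGraph

universe u

/-- `v` and `w` are equal or joined by an edge. -/
def Near {V : Type*} (G : SimpleGraph V) (v w : V) : Prop := v = w ∨ G.Adj v w

/-- A graph map: every edge is sent to an edge or collapsed to a vertex. -/
@[ext]
structure GraphMap {V W : Type*} (G : SimpleGraph V) (H : SimpleGraph W) where
  toFun : V → W
  map_adj : ∀ v w : V, G.Adj v w → Near H (toFun v) (toFun w)

instance {V W : Type*} (G : SimpleGraph V) (H : SimpleGraph W) :
    CoeFun (GraphMap G H) (fun _ => V → W) := ⟨GraphMap.toFun⟩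

/-- The line graph with vertices `0, 1, ..., n` and edges `k ∼ k + 1`. -/
abbrev line (n : ℕ) : SimpleGraph (Fin (n + 1)) := pathGraph (n + 1)

/-- A loop of length `n` in the based graph `(G, b)`: a graph map from the line graph on
`0, ..., n` to `G` that sends both endpoints to `b`. -/
structure Loop {V : Type u} (G : SimpleGraph V) (b : V) (n : ℕ) extends
    GraphMap (line n) G where
  map_zero : toFun 0 = b
  map_last : toFun (Fin.last n) = b

/-- A shrinking map between line graphs: a monotone graph map preserving both endpoints. -/
structure IsShrinking {n m : ℕ} (h : GraphMap (line n) (line m)) : Prop where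
  map_zero : h 0 = 0
  map_last : h (Fin.last n) = Fin.last m
  mono : ∀ i j : Fin (n + 1), i ≤ j → h i ≤ h j

/-- `Φ'` is a stabilization of `Φ`: it is the composition of `Φ` with a shrinking map that
restricts to the identity on the vertices `0, ..., m`. -/
def IsStabilization {V : Type u} {G : SimpleGraph V} {b : V} {n m : ℕ}
    (Φ' : Loop G b n) (Φ : Loop G b m) : Prop :=
  ∃ h : GraphMap (line n) (line m), IsShrinking h ∧
    (∀ (i : Fin (n + 1)) (j : Fin (m + 1)), (i : ℕ) = (j : ℕ) → h i = j) ∧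
    ∀ i, Φ'.toFun i = Φ.toFun (h i)

/-- Two loops of the same length are homotopic (as loops, that is, relative to both endpoints)
if there is a graph map from a cylinder `line n □ line k` to `G` which restricts to
the two loops at the two ends and to the base vertex on `{0, n} □ line k`. -/
def LoopHomotopic {V : Type u} {G : SimpleGraph V} {b : V} {n : ℕ} (Φ Ψ : Loop G b n) : Prop :=
  ∃ (k : ℕ) (F : GraphMap (line n □ line k) G),
    (∀ i, F (i, 0) = Φ.toFun i) ∧ (∀ i, F (i, Fin.last k) = Ψ.toFun i) ∧
    (∀ t, F (0, t) = b) ∧ (∀ t, F (Fin.last n, t) = b)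

/-- Two loops are `S`-homotopic if they have homotopic stabilizations. -/
def SHomotopic {V : Type u} {G : SimpleGraph V} {b : V} {n m : ℕ}
    (Φ : Loop G b n) (Ψ : Loop G b m) : Prop :=
  ∃ (N : ℕ) (Φ' Ψ' : Loop G b N),
    IsStabilization Φ' Φ ∧ IsStabilization Ψ' Ψ ∧ LoopHomotopic Φ' Ψ'

/-! ### Auxiliary description of loops by eventually constant sequences -/

section Aux

variable {V : Type u} {G : SimpleGraph V} {b : V}

theorem Near.refl (v : V) : Near G v v := Or.inl rfl

theorem Near.symm {v w : V} (h : Near G v w) : Near G w v :=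
  h.elim (fun h => Or.inl h.symm) (fun h => Or.inr h.symm)

/-- `f` is a walk starting at `b` and staying at `b` from time `N` on. -/
structure IsLoopSeq (G : SimpleGraph V) (b : V) (f : ℕ → V) (N : ℕ) : Prop where
  zero : f 0 = b
  near : ∀ i, Near G (f i) (f (i + 1))
  stable : ∀ i, N ≤ i → f i = b

theorem IsLoopSeq.mono {f : ℕ → V} {N M : ℕ} (h : IsLoopSeq G b f N) (hNM : N ≤ M) :
    IsLoopSeq G b f M :=
  ⟨h.zero, h.near, fun i hi => h.stable i (hNM.trans hi)⟩

/-- The extension of a loop by the constant base vertex. -/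
def Loop.seq {n : ℕ} (Φ : Loop G b n) (i : ℕ) : V := Φ.toFun ⟨min i n, by omega⟩

theorem GraphMap.near_of_succ {n : ℕ} (f : GraphMap (line n) G) (i j : Fin (n + 1))
    (h : (j : ℕ) = i ∨ (j : ℕ) = i + 1) : Near G (f i) (f j) := by
  rcases h with h | h
  · rw [Fin.ext h]; exact Near.refl _
  · exact f.map_adj i j (pathGraph_adj.2 (Or.inl h.symm))

theorem Loop.isLoopSeq {n : ℕ} (Φ : Loop G b n) : IsLoopSeq G b Φ.seq n where
  zero := by simpa [Loop.seq] using Φ.map_zero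
  near i := Φ.toGraphMap.near_of_succ _ _ (by simp only; omega)
  stable i hi := by
    have : (⟨min i n, by omega⟩ : Fin (n + 1)) = Fin.last n := Fin.ext (by simp [hi])
    simp only [Loop.seq, this]; exact Φ.map_last

/-- The graph map on a line graph given by a walk indexed by the natural numbers. -/
def GraphMap.ofSeq (f : ℕ → V) (hf : ∀ i, Near G (f i) (f (i + 1))) (n : ℕ) :
    GraphMap (line n) G where
  toFun i := f i
  map_adj i j h := by
    rcases pathGraph_adj.1 h with h | h
    · rw [← h]; exact hf _
    · rw [← h]; exact (hf _).symm

/-- The loop of length `n` given by an eventually constant sequence. -/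
def Loop.ofSeq {n : ℕ} (f : ℕ → V) (hf : IsLoopSeq G b f n) : Loop G b n where
  toGraphMap := GraphMap.ofSeq f hf.near n
  map_zero := hf.zero
  map_last := by simpa [GraphMap.ofSeq] using hf.stable n le_rfl

theorem Loop.seq_ofSeq {n : ℕ} (f : ℕ → V) (hf : IsLoopSeq G b f n) :
    (Loop.ofSeq f hf).seq = f := by
  funext i
  simp only [Loop.seq, Loop.ofSeq, GraphMap.ofSeq]
  rcases le_total i n with h | h
  · rw [min_eq_left h]
  · rw [min_eq_right h, hf.stable i h, hf.stable n le_rfl]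

theorem IsStabilization.seq_eq {n m : ℕ} {Φ' : Loop G b n} {Φ : Loop G b m}
    (H : IsStabilization Φ' Φ) : m ≤ n ∧ Φ'.seq = Φ.seq := by
  obtain ⟨h, hs, hid, hc⟩ := H
  have hle : ∀ (k : ℕ) (hk : k < n + 1), (h ⟨k, hk⟩ : ℕ) ≤ k := by
    intro k
    induction k with
    | zero => intro hk; exact le_of_eq (congrArg Fin.val hs.map_zero)
    | succ k ih =>
      intro hk
      have h1 := ih (by omega)
      rcases h.map_adj ⟨k, by omega⟩ ⟨k + 1, hk⟩ (pathGraph_adj.2 (Or.inl rfl)) with h2 | h2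
      · rw [← h2]; omega
      · rcases pathGraph_adj.1 h2 with h3 | h3 <;> omega
  have hmn : m ≤ n := by
    have h1 := hle n (by omega)
    have h2 : (h ⟨n, by omega⟩ : ℕ) = m := congrArg Fin.val hs.map_last
    omega
  refine ⟨hmn, ?_⟩
  funext i
  simp only [Loop.seq, hc]
  congr 1
  rcases le_total i m with hi | hi
  · exact hid _ _ (by simp only; omega)
  · have h1 : h ⟨m, by omega⟩ = ⟨m, by omega⟩ := hid _ _ rfl
    have h2 := hs.mono ⟨m, by omega⟩ ⟨min i n, by omega⟩ (Fin.mk_le_mk.2 (by omega))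
    rw [h1] at h2
    apply Fin.ext
    have h3 := (h ⟨min i n, by omega⟩).isLt
    have h4 : m ≤ (h ⟨min i n, by omega⟩ : ℕ) := h2
    simp only; omega

theorem Loop.isStabilization_ofSeq {n m : ℕ} (Φ : Loop G b m) (hmn : m ≤ n) :
    IsStabilization (Loop.ofSeq Φ.seq (Φ.isLoopSeq.mono hmn)) Φ := by
  refine ⟨⟨fun i => ⟨min i m, by omega⟩, ?_⟩, ⟨?_, ?_, ?_⟩, ?_, ?_⟩
  · intro i j h
    by_cases h' : min (i : ℕ) m = min (j : ℕ) m
    · exact Or.inl (Fin.ext h')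
    · refine Or.inr (pathGraph_adj.2 ?_)
      have := pathGraph_adj.1 h
      simp only; omega
  · exact Fin.ext (by simp)
  · exact Fin.ext (by simp [hmn])
  · intro i j hij
    have : (i : ℕ) ≤ j := hij
    exact Fin.mk_le_mk.2 (by omega)
  · intro i j hij
    exact Fin.ext (by simp only; omega)
  · intro i; rfl

/-- One step of a homotopy of eventually constant sequences. -/
structure Step (G : SimpleGraph V) (b : V) (f g : ℕ → V) : Prop where
  left : ∃ N, IsLoopSeq G b f N
  right : ∃ N, IsLoopSeq G b g N
  near : ∀ i, Near G (f i) (g i)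

/-- Homotopy of eventually constant sequences. -/
def SeqHomotopic (G : SimpleGraph V) (b : V) : (ℕ → V) → (ℕ → V) → Prop :=
  Relation.ReflTransGen (Step G b)

theorem SeqHomotopic.symm {f g : ℕ → V} (h : SeqHomotopic G b f g) : SeqHomotopic G b g f := by
  induction h with
  | refl => exact Relation.ReflTransGen.refl
  | tail _ hs ih =>
    exact Relation.ReflTransGen.head ⟨hs.right, hs.left, fun i => (hs.near i).symm⟩ ih

theorem SeqHomotopic.trans {f g h : ℕ → V} (h₁ : SeqHomotopic G b f g)
    (h₂ : SeqHomotopic G b g h) : SeqHomotopic G b f h :=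
  Relation.ReflTransGen.trans h₁ h₂

theorem SeqHomotopic.exists_grid {f g : ℕ → V} (hf : ∃ N, IsLoopSeq G b f N)
    (h : SeqHomotopic G b f g) :
    ∃ (k N : ℕ) (F : ℕ → ℕ → V), F 0 = f ∧ F k = g ∧ (∀ t, IsLoopSeq G b (F t) N) ∧
      ∀ t i, Near G (F t i) (F (t + 1) i) := by
  induction h with
  | refl =>
    obtain ⟨N, hN⟩ := hf
    exact ⟨0, N, fun _ => f, rfl, rfl, fun _ => hN, fun _ _ => Near.refl _⟩
  | @tail g' g _ hs ih =>
    obtain ⟨k, N, F, h0, hk, hF, hn⟩ := ih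
    obtain ⟨M, hM⟩ := hs.right
    refine ⟨k + 1, max N M, fun t => if t ≤ k then F t else g, by simp [h0], by simp, ?_, ?_⟩
    · intro t
      by_cases ht : t ≤ k
      · simp only [ht, if_true]; exact (hF t).mono (le_max_left _ _)
      · simp only [ht, if_false]; exact hM.mono (le_max_right _ _)
    · intro t i
      rcases lt_trichotomy t k with ht | rfl | ht
      · have h1 : t ≤ k := by omega
        have h2 : t + 1 ≤ k := by omega
        simp only [h1, h2, if_true]; exact hn t i
      · simp only [le_refl, if_true, Nat.not_succ_le_self, if_false, hk]; exact hs.near i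
      · have h1 : ¬ t ≤ k := by omega
        have h2 : ¬ t + 1 ≤ k := by omega
        simp only [h1, h2, if_false]; exact Near.refl _

theorem sHomotopic_iff {n m : ℕ} (Φ : Loop G b n) (Ψ : Loop G b m) :
    SHomotopic Φ Ψ ↔ SeqHomotopic G b Φ.seq Ψ.seq := by
  constructor
  · rintro ⟨N, Φ', Ψ', hΦ, hΨ, k, F, h0, hk, hl, hr⟩
    rw [← hΦ.seq_eq.2, ← hΨ.seq_eq.2]
    have hrow : ∀ t : Fin (k + 1), IsLoopSeq G b
        (fun i => F (⟨min i N, by omega⟩, t)) N := by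
      intro t
      let Θ : Loop G b N :=
        { toFun := fun i => F (i, t)
          map_adj := fun i j h => F.map_adj _ _ (boxProd_adj_left.2 h)
          map_zero := hl t
          map_last := hr t }
      exact Θ.isLoopSeq
    have key : ∀ (t : ℕ) (ht : t < k + 1),
        SeqHomotopic G b Φ'.seq (fun i => F (⟨min i N, by omega⟩, ⟨t, ht⟩)) := by
      intro t
      induction t with
      | zero =>
        intro ht
        have : Φ'.seq = fun i => F (⟨min i N, by omega⟩, ⟨0, ht⟩) := by
          funext i; exact (h0 _).symm
        rw [this]; exact Relation.ReflTransGen.refl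
      | succ t ih =>
        intro ht
        refine (ih (by omega)).tail ⟨⟨N, hrow _⟩, ⟨N, hrow _⟩, fun i => ?_⟩
        exact F.map_adj _ _ (boxProd_adj_right.2 (pathGraph_adj.2 (Or.inl rfl)))
    have hlast := key k (by omega)
    have : Ψ'.seq = fun i => F (⟨min i N, by omega⟩, ⟨k, by omega⟩) := by
      funext i; exact (hk _).symm
    rw [this]; exact hlast
  · intro h
    obtain ⟨k, N, F, h0, hk, hF, hn⟩ := h.exists_grid ⟨n, Φ.isLoopSeq⟩
    refine ⟨max N (max n m), _, _, Φ.isStabilization_ofSeq (by omega),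
      Ψ.isStabilization_ofSeq (by omega), k, ⟨fun p => F p.2 p.1, ?_⟩, ?_, ?_, ?_, ?_⟩
    · rintro ⟨i, t⟩ ⟨j, s⟩ h
      rcases boxProd_adj.1 h with ⟨h1, h2⟩ | ⟨h1, h2⟩
      · obtain rfl : t = s := h2
        exact (GraphMap.ofSeq (F t) (hF t).near _).map_adj i j h1
      · obtain rfl : i = j := h2
        exact (GraphMap.ofSeq (fun t => F t i) (fun t => hn t i) k).map_adj t s h1
    · intro i; exact congrFun h0 i
    · intro i; exact congrFun hk i
    · intro t; exact (hF t).zero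
    · intro t; exact (hF t).stable _ (by simp)

theorem SHomotopic.refl {n : ℕ} (Φ : Loop G b n) : SHomotopic Φ Φ :=
  (sHomotopic_iff _ _).2 Relation.ReflTransGen.refl

theorem SHomotopic.symm {n m : ℕ} {Φ : Loop G b n} {Ψ : Loop G b m} (h : SHomotopic Φ Ψ) :
    SHomotopic Ψ Φ :=
  (sHomotopic_iff _ _).2 ((sHomotopic_iff _ _).1 h).symm

theorem SHomotopic.trans {n m k : ℕ} {Φ : Loop G b n} {Ψ : Loop G b m} {Θ : Loop G b k}
    (h₁ : SHomotopic Φ Ψ) (h₂ : SHomotopic Ψ Θ) : SHomotopic Φ Θ :=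
  (sHomotopic_iff _ _).2 (((sHomotopic_iff _ _).1 h₁).trans ((sHomotopic_iff _ _).1 h₂))

theorem sHomotopic_of_eq {n m : ℕ} {Φ : Loop G b n} {Ψ : Loop G b m}
    (h : ∀ i, Φ.seq i = Ψ.seq i) : SHomotopic Φ Ψ := by
  rw [sHomotopic_iff, funext h]; exact Relation.ReflTransGen.refl

end Aux

/-! ### Operations on loops -/

section Operations

variable {V : Type u} {G : SimpleGraph V} {b : V}

/-- The trivial loop of length `0`. -/
def Loop.trivial (G : SimpleGraph V) (b : V) : Loop G b 0 where
  toFun _ := b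
  map_adj _ _ _ := Near.refl _
  map_zero := rfl
  map_last := rfl

/-- The inverse loop `i ↦ Φ (n - i)`. -/
def Loop.inverse {n : ℕ} (Φ : Loop G b n) : Loop G b n where
  toFun i := Φ.toFun i.rev
  map_adj i j h := by
    refine Φ.map_adj _ _ (pathGraph_adj.2 ?_)
    have := pathGraph_adj.1 h
    simp only [Fin.val_rev]; omega
  map_zero := by simpa using Φ.map_last
  map_last := by simpa using Φ.map_zero

/-- The concatenation of two loops. -/
def Loop.concat {n m : ℕ} (Φ : Loop G b n) (Ψ : Loop G b m) : Loop G b (n + m) where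
  toFun i := if h : (i : ℕ) ≤ n then Φ.toFun ⟨i, by omega⟩ else Ψ.toFun ⟨i - n, by omega⟩
  map_adj := by
    have key : ∀ i j : Fin (n + m + 1), (i : ℕ) + 1 = j → Near G
        (if h : (i : ℕ) ≤ n then Φ.toFun ⟨i, by omega⟩ else Ψ.toFun ⟨i - n, by omega⟩)
        (if h : (j : ℕ) ≤ n then Φ.toFun ⟨j, by omega⟩ else Ψ.toFun ⟨j - n, by omega⟩) := by
      intro i j hij
      by_cases hj : (j : ℕ) ≤ n
      · have hi : (i : ℕ) ≤ n := by omega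
        rw [dif_pos hi, dif_pos hj]
        exact Φ.toGraphMap.near_of_succ _ _ (Or.inr hij.symm)
      · by_cases hi : (i : ℕ) ≤ n
        · rw [dif_pos hi, dif_neg hj]
          have h1 : (⟨i, by omega⟩ : Fin (n + 1)) = Fin.last n :=
            Fin.ext (by simp only [Fin.val_last]; omega)
          rw [h1, Φ.map_last.trans Ψ.map_zero.symm]
          exact Ψ.toGraphMap.near_of_succ _ _
            (Or.inr (by simp only [Fin.val_zero]; omega))
        · rw [dif_neg hi, dif_neg hj]
          exact Ψ.toGraphMap.near_of_succ _ _ (Or.inr (by simp only; omega))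
    intro i j h
    rcases pathGraph_adj.1 h with h | h
    · exact key i j h
    · exact (key j i h).symm
  map_zero := by simpa using Φ.map_zero
  map_last := by
    by_cases hm : m = 0
    · subst hm; simpa [Fin.last] using Φ.map_last
    · have h1 : ¬ ((Fin.last (n + m) : Fin (n + m + 1)) : ℕ) ≤ n := by
        simp only [Fin.val_last]; omega
      rw [dif_neg h1]
      have h2 : (⟨(Fin.last (n + m) : Fin (n + m + 1)) - n, by simp⟩ : Fin (m + 1))
          = Fin.last m := Fin.ext (by simp)
      rw [h2]; exact Ψ.map_last

theorem Loop.seq_trivial (i : ℕ) : (Loop.trivial G b).seq i = b := rfl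

theorem Loop.seq_inverse {n : ℕ} (Φ : Loop G b n) (i : ℕ) : Φ.inverse.seq i = Φ.seq (n - i) := by
  simp only [Loop.seq, Loop.inverse]
  congr 1
  exact Fin.ext (by simp only [Fin.val_rev]; omega)

/-- Concatenation of sequences at time `n`. -/
def cat (n : ℕ) (f g : ℕ → V) (i : ℕ) : V := if i ≤ n then f i else g (i - n)

theorem Loop.seq_concat {n m : ℕ} (Φ : Loop G b n) (Ψ : Loop G b m) :
    (Φ.concat Ψ).seq = cat n Φ.seq Ψ.seq := by
  funext i
  simp only [Loop.seq, Loop.concat, cat]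
  by_cases hi : i ≤ n
  · have h1 : min i (n + m) ≤ n := by omega
    rw [dif_pos h1, if_pos hi]
    congr 1
    exact Fin.ext (by simp only; omega)
  · rw [if_neg hi]
    by_cases h1 : min i (n + m) ≤ n
    · rw [dif_pos h1]
      have hm : m = 0 := by omega
      subst hm
      have h2 : (⟨min i (n + 0), by omega⟩ : Fin (n + 1)) = Fin.last n :=
        Fin.ext (by simp only [Fin.val_last]; omega)
      have h3 : (⟨min (i - n) 0, by omega⟩ : Fin (0 + 1)) = Fin.last 0 :=
        Fin.ext (by simp only [Fin.val_last]; omega)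
      rw [h2, h3, Φ.map_last, Ψ.map_last]
    · rw [dif_neg h1]
      congr 1
      exact Fin.ext (by simp only; omega)

theorem IsLoopSeq.cat {f g : ℕ → V} {n m : ℕ} (hf : IsLoopSeq G b f n) (hg : IsLoopSeq G b g m) :
    IsLoopSeq G b (cat n f g) (n + m) := by
  have h := ((Loop.ofSeq f hf).concat (Loop.ofSeq g hg)).isLoopSeq
  rwa [Loop.seq_concat, Loop.seq_ofSeq, Loop.seq_ofSeq] at h

theorem seqHomotopic_cat_of_le {f g : ℕ → V} {n m N : ℕ} (hf : IsLoopSeq G b f n)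
    (hg : IsLoopSeq G b g m) (hnN : n ≤ N) : SeqHomotopic G b (cat n f g) (cat N f g) := by
  induction N, hnN using Nat.le_induction with
  | base => exact Relation.ReflTransGen.refl
  | succ N hN ih =>
    have h1 := (hf.mono hN).cat hg
    refine ih.tail ⟨⟨_, h1⟩, ⟨_, (hf.mono (hN.trans N.le_succ)).cat hg⟩, fun i => ?_⟩
    rcases Nat.lt_or_ge N i with hi | hi
    · have h2 : ATheory.cat (N + 1) f g i = ATheory.cat N f g (i - 1) := by
        simp only [ATheory.cat]
        by_cases h3 : i ≤ N + 1
        · rw [if_pos h3, if_pos (by omega : i - 1 ≤ N), hf.stable i (by omega),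
            hf.stable (i - 1) (by omega)]
        · rw [if_neg h3, if_neg (by omega : ¬ i - 1 ≤ N)]
          congr 1; omega
      rw [h2]
      have h4 := (h1.near (i - 1)).symm
      rwa [show i - 1 + 1 = i by omega] at h4
    · refine Or.inl ?_
      simp only [ATheory.cat]
      rw [if_pos hi, if_pos (by omega)]

theorem seqHomotopic_cat_left {f f' g : ℕ → V} {n n' m : ℕ} (hf : IsLoopSeq G b f n)
    (hf' : IsLoopSeq G b f' n') (hg : IsLoopSeq G b g m) (h : SeqHomotopic G b f f') :
    SeqHomotopic G b (cat n f g) (cat n' f' g) := by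
  induction h generalizing n' with
  | refl =>
    exact (seqHomotopic_cat_of_le hf hg (le_max_left n n')).trans
      (seqHomotopic_cat_of_le hf' hg (le_max_right n n')).symm
  | @tail f₁ f₂ _ hs ih =>
    obtain ⟨n₁, hn₁⟩ := hs.left
    have h1 : IsLoopSeq G b f₁ (max n₁ n') := hn₁.mono (le_max_left _ _)
    have h2 : IsLoopSeq G b f₂ (max n₁ n') := hf'.mono (le_max_right _ _)
    refine SeqHomotopic.trans ((ih h1).tail ⟨⟨_, h1.cat hg⟩, ⟨_, h2.cat hg⟩, fun i => ?_⟩)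
      (seqHomotopic_cat_of_le hf' hg (le_max_right n₁ n')).symm
    simp only [ATheory.cat]
    split_ifs
    · exact hs.near i
    · exact Near.refl _

theorem seqHomotopic_cat_right {f g g' : ℕ → V} {n : ℕ} (hf : IsLoopSeq G b f n)
    (h : SeqHomotopic G b g g') :
    SeqHomotopic G b (cat n f g) (cat n f g') := by
  induction h with
  | refl => exact Relation.ReflTransGen.refl
  | tail _ hs ih =>
    obtain ⟨_, h1⟩ := hs.left
    obtain ⟨_, h2⟩ := hs.right
    refine ih.tail ⟨⟨_, hf.cat h1⟩, ⟨_, hf.cat h2⟩, fun i => ?_⟩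
    simp only [ATheory.cat]
    split_ifs
    · exact Near.refl _
    · exact hs.near _

theorem SHomotopic.concat {n n' m m' : ℕ} {Φ : Loop G b n} {Φ' : Loop G b n'} {Ψ : Loop G b m}
    {Ψ' : Loop G b m'} (h₁ : SHomotopic Φ Φ') (h₂ : SHomotopic Ψ Ψ') :
    SHomotopic (Φ.concat Ψ) (Φ'.concat Ψ') := by
  rw [sHomotopic_iff] at *
  rw [Loop.seq_concat, Loop.seq_concat]
  exact (seqHomotopic_cat_left Φ.isLoopSeq Φ'.isLoopSeq Ψ.isLoopSeq h₁).trans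
    (seqHomotopic_cat_right Φ'.isLoopSeq h₂)

theorem Loop.inverse_concat {n : ℕ} (Φ : Loop G b n) :
    SHomotopic (Φ.inverse.concat Φ) (Loop.trivial G b) := by
  rw [sHomotopic_iff]
  have hΦ := Φ.isLoopSeq
  have hnear : ∀ i j, i ≤ j → j ≤ i + 1 → Near G (Φ.seq i) (Φ.seq j) := by
    intro i j h1 h2
    rcases Nat.lt_or_ge i j with h | h
    · rw [show j = i + 1 by omega]; exact hΦ.near i
    · rw [show j = i by omega]; exact Near.refl _
  have hnear' : ∀ i j, i ≤ j + 1 → j ≤ i + 1 → Near G (Φ.seq i) (Φ.seq j) := by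
    intro i j h1 h2
    rcases le_total i j with h | h
    · exact hnear i j h h2
    · exact (hnear j i h h1).symm
  have hloop : ∀ t, IsLoopSeq G b (fun i => Φ.seq (max (max (n - i) (i - n)) t)) (n + n) := by
    intro t
    refine ⟨hΦ.stable _ (by omega), fun i => hnear' _ _ (by omega) (by omega),
      fun i hi => hΦ.stable _ (by omega)⟩
  have key : ∀ t, SeqHomotopic G b (Φ.inverse.concat Φ).seq
      (fun i => Φ.seq (max (max (n - i) (i - n)) t)) := by
    intro t
    induction t with
    | zero =>
      have : (Φ.inverse.concat Φ).seq = fun i => Φ.seq (max (max (n - i) (i - n)) 0) := by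
        funext i
        rw [Loop.seq_concat, ATheory.cat]
        split_ifs with hi
        · rw [Loop.seq_inverse]; congr 1; omega
        · congr 1; omega
      rw [this]; exact Relation.ReflTransGen.refl
    | succ t ih =>
      exact ih.tail ⟨⟨_, hloop t⟩, ⟨_, hloop (t + 1)⟩,
        fun i => hnear' _ _ (by omega) (by omega)⟩
  have hn := key n
  have : (fun i => Φ.seq (max (max (n - i) (i - n)) n)) = (Loop.trivial G b).seq := by
    funext i
    rw [Loop.seq_trivial]; exact hΦ.stable _ (by omega)
  rwa [this] at hn

theorem Loop.concat_assoc {p q r : ℕ} (A : Loop G b p) (B : Loop G b q) (C : Loop G b r) :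
    SHomotopic ((A.concat B).concat C) (A.concat (B.concat C)) := by
  refine sHomotopic_of_eq fun i => ?_
  simp only [Loop.seq_concat, ATheory.cat]
  by_cases h1 : i ≤ p
  · rw [if_pos (by omega), if_pos h1, if_pos h1]
  · rw [if_neg h1, if_neg h1]
    by_cases h2 : i ≤ p + q
    · rw [if_pos h2, if_pos (by omega)]
    · rw [if_neg h2, if_neg (by omega)]
      congr 1; omega

theorem Loop.trivial_concat {n : ℕ} (Φ : Loop G b n) :
    SHomotopic ((Loop.trivial G b).concat Φ) Φ := by
  refine sHomotopic_of_eq fun i => ?_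
  simp only [Loop.seq_concat, ATheory.cat, Loop.seq_trivial]
  split_ifs with h
  · rw [show i = 0 by omega, Φ.isLoopSeq.zero]
  · rfl

theorem Loop.concat_trivial {n : ℕ} (Φ : Loop G b n) :
    SHomotopic (Φ.concat (Loop.trivial G b)) Φ := by
  refine sHomotopic_of_eq fun i => ?_
  simp only [Loop.seq_concat, ATheory.cat, Loop.seq_trivial]
  split_ifs with h
  · rfl
  · exact (Φ.isLoopSeq.stable i (by omega)).symm

theorem Loop.concat_inverse {n : ℕ} (Φ : Loop G b n) :
    SHomotopic (Φ.concat Φ.inverse) (Loop.trivial G b) := by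
  have h := Φ.inverse.inverse_concat
  have h2 : SHomotopic Φ.inverse.inverse Φ := by
    refine sHomotopic_of_eq fun i => ?_
    simp only [Loop.seq, Loop.inverse, Fin.rev_rev]
  exact (h2.symm.concat (SHomotopic.refl _)).trans h

theorem SHomotopic.inverse {n m : ℕ} {Φ : Loop G b n} {Ψ : Loop G b m} (h : SHomotopic Φ Ψ) :
    SHomotopic Φ.inverse Ψ.inverse :=
  Φ.inverse.concat_trivial.symm.trans <|
    ((SHomotopic.refl _).concat Ψ.concat_inverse.symm).trans <|
    (Loop.concat_assoc _ _ _).symm.trans <|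
    (((SHomotopic.refl _).concat h.symm).trans Φ.inverse_concat |>.concat
      (SHomotopic.refl _)).trans Ψ.inverse.trivial_concat

end Operations

/-! ### The fundamental group -/

/-- `S`-homotopy as an equivalence relation on the loops of all lengths. -/
def loopSetoid {V : Type u} (G : SimpleGraph V) (b : V) : Setoid (Σ n : ℕ, Loop G b n) where
  r Φ Ψ := SHomotopic Φ.2 Ψ.2
  iseqv := ⟨fun Φ => SHomotopic.refl Φ.2, fun h => h.symm, fun h₁ h₂ => h₁.trans h₂⟩

/-- The fundamental group of the based graph `(G, b)`: `S`-homotopy classes of loops. -/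
def FundamentalGroup {V : Type u} (G : SimpleGraph V) (b : V) : Type u :=
  Quotient (loopSetoid G b)

/-- The group structure: the product is induced by concatenation of loops, the neutral element
is the class of the trivial loop, and inverses are given by reversing loops. -/
instance {V : Type u} (G : SimpleGraph V) (b : V) : Group (FundamentalGroup G b) where
  mul := Quotient.map₂ (fun Φ Ψ => ⟨Φ.1 + Ψ.1, Φ.2.concat Ψ.2⟩)
    (fun _ _ h₁ _ _ h₂ => SHomotopic.concat h₁ h₂)
  one := Quotient.mk _ ⟨0, Loop.trivial G b⟩
  inv := Quotient.map (fun Φ => ⟨Φ.1, Φ.2.inverse⟩) (fun _ _ h => SHomotopic.inverse h)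
  mul_assoc := by
    rintro ⟨Φ⟩ ⟨Ψ⟩ ⟨Θ⟩
    exact Quotient.sound (Loop.concat_assoc Φ.2 Ψ.2 Θ.2)
  one_mul := by
    rintro ⟨Φ⟩
    exact Quotient.sound (Loop.trivial_concat Φ.2)
  mul_one := by
    rintro ⟨Φ⟩
    exact Quotient.sound (Loop.concat_trivial Φ.2)
  inv_mul_cancel := by
    rintro ⟨Φ⟩
    exact Quotient.sound (Loop.inverse_concat Φ.2)

end ATheory

/-! ## Path homology of digraphs -/

namespace PathHomology

universe u

/-- A digraph without edges from a vertex to itself. -/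
structure LooplessDigraph (V : Type u) extends Digraph V where
  loopless : ∀ v : V, ¬ Adj v v

/-- The double digraph of a graph: `v → w` if and only if `v ∼ w`. -/
def doubleDigraph {V : Type u} (G : SimpleGraph V) : LooplessDigraph V where
  Adj := G.Adj
  loopless v := G.loopless.irrefl v

/-- `p`-paths on `V`: formal integral linear combinations of elementary `p`-paths `i₀ ... i_p`. -/
abbrev Chain (V : Type u) (p : ℕ) : Type u :=
  (Fin (p + 1) → V) →₀ ℤ

/-- An elementary path is regular if consecutive vertices are distinct. -/
def IsRegular {V : Type u} {p : ℕ} (i : Fin (p + 1) → V) : Prop :=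
  ∀ k : Fin p, i k.castSucc ≠ i k.succ

/-- An elementary path is allowed if consecutive vertices are joined by arrows. -/
def IsAllowed {V : Type u} (D : LooplessDigraph V) {p : ℕ} (i : Fin (p + 1) → V) : Prop :=
  ∀ k : Fin p, D.Adj (i k.castSucc) (i k.succ)

noncomputable section

/-- The boundary operator on all paths: the alternating sum over the omission of one vertex. -/
def boundary (V : Type u) (p : ℕ) :
    Chain V (p + 1) →ₗ[ℤ] Chain V p :=
  Finsupp.linearCombination ℤ fun i : Fin (p + 2) → V =>
    ∑ q : Fin (p + 2), Finsupp.single (fun k => i (q.succAbove k)) ((-1 : ℤ) ^ (q : ℕ))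

open scoped Classical in
/-- The projection onto the span of the regular paths that sets irregular paths to zero. -/
def regularize (V : Type u) (p : ℕ) :
    Chain V p →ₗ[ℤ] Chain V p :=
  Finsupp.linearCombination ℤ fun i : Fin (p + 1) → V =>
    if IsRegular i then Finsupp.single i (1 : ℤ) else 0

/-- The boundary operator on regular paths: the quotient of all paths by the irregular ones is
identified with the span of the regular paths, that is, irregular paths are set to zero. -/
def regBoundary (V : Type u) (p : ℕ) :
    Chain V (p + 1) →ₗ[ℤ] Chain V p :=
  regularize V p ∘ₗ boundary V p

/-- The module of allowed `p`-paths. All of these are regular. -/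
def allowed {V : Type u} (D : LooplessDigraph V) (p : ℕ) :
    Submodule ℤ (Chain V p) :=
  Submodule.span ℤ {c | ∃ i : Fin (p + 1) → V, IsAllowed D i ∧ c = Finsupp.single i (1 : ℤ)}

/-- The module of boundary-invariant `p`-paths: allowed paths with allowed boundary. -/
def invariant {V : Type u} (D : LooplessDigraph V) :
    (p : ℕ) → Submodule ℤ (Chain V p)
  | 0 => allowed D 0
  | p + 1 => allowed D (p + 1) ⊓ (allowed D p).comap (regBoundary V p)

/-- Closed boundary-invariant `p`-paths; the boundary of a `0`-path is zero. -/
def cycles {V : Type u} (D : LooplessDigraph V) :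
    (p : ℕ) → Submodule ℤ (Chain V p)
  | 0 => invariant D 0
  | p + 1 => invariant D (p + 1) ⊓ LinearMap.ker (regBoundary V p)

/-- Boundaries of boundary-invariant `(p + 1)`-paths. -/
def boundaries {V : Type u} (D : LooplessDigraph V) (p : ℕ) :
    Submodule ℤ (Chain V p) :=
  (invariant D (p + 1)).map (regBoundary V p)

/-- The path homology `H_p(D, ℤ)` of a digraph: cycles modulo boundaries. -/
abbrev pathHomology {V : Type u} (D : LooplessDigraph V) (p : ℕ) :
    Type u :=
  cycles D p ⧸ (boundaries D p).submoduleOf (cycles D p)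

/-- The homology of a graph: the path homology of its double digraph. -/
abbrev graphHomology {V : Type u} (G : SimpleGraph V) (p : ℕ) :
    Type u :=
  pathHomology (doubleDigraph G) p

end

end PathHomology

/-! Summing the edges of a loop gives a 1-cycle. A homotopy between loops is a grid of squares, some
degenerate, and each square is the boundary of a difference of two triangles with a common diagonal,
so the homology class depends only on the S-homotopy class (`square_mem_boundaries`,
`seqChain_sub_mem_of_step`). This gives `hurewicz` and, as homology is commutative, `abHurewicz`.

Injectivity needs a map back. Fix walks from the base vertex to all vertices and close up any walk
by them. On the group side, walks of length at most two with the same ends are interchangeable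
inside a loop (`walkClass_eq_of_short`). So every pair of vertices at distance at most two has a
well-defined class, even if not adjacent, and `chainClass` extends it linearly to 1-chains. It kills
the boundary of each allowed triangle separately (`chainClass_regBoundary`), so it kills all
boundaries, and it returns the class of a closed walk from its chain. Every element comes from a
closed walk (`exists_walkClass_eq`).

For surjectivity, the loop attached to an edge has as its chain that edge minus the cone over its
boundary, modulo boundaries. On a cycle the cone term vanishes (`homologyToQuotient_chainClass`). -/

namespace ATheory

open SimpleGraph

/-! ### Waiting steps in loops, and closed walks as loops -/

section Walks

universe u

variable {V : Type u} {G : SimpleGraph V} {b : V}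

/-- The sequence that waits for one additional step at time `n`. -/
def delay (n : ℕ) (f : ℕ → V) (i : ℕ) : V := if i ≤ n then f i else f (i - 1)

theorem IsLoopSeq.delay {f : ℕ → V} {N : ℕ} (hf : IsLoopSeq G b f N) (n : ℕ) :
    IsLoopSeq G b (delay n f) (N + 1) where
  zero := hf.zero
  near i := by
    simp only [ATheory.delay]
    rcases lt_trichotomy i n with h | rfl | h
    · rw [if_pos h.le, if_pos (Nat.succ_le_of_lt h)]; exact hf.near i
    · rw [if_pos le_rfl, if_neg (by omega)]; exact Near.refl _
    · rw [if_neg (by omega), if_neg (by omega)]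
      have := hf.near (i - 1)
      rwa [show i - 1 + 1 = i + 1 - 1 by omega] at this
  stable i hi := by
    simp only [ATheory.delay]
    split_ifs
    · exact hf.stable _ (by omega)
    · exact hf.stable _ (by omega)

/-- At each time the delayed sequence is at most one step behind, so a single homotopy step
suffices. Stabilization inserts pauses only at the end of a loop; this inserts or removes them
anywhere. -/
theorem IsLoopSeq.homotopic_delay {f : ℕ → V} {N : ℕ} (hf : IsLoopSeq G b f N) (n : ℕ) :
    SeqHomotopic G b f (ATheory.delay n f) := by
  refine Relation.ReflTransGen.single ⟨⟨_, hf⟩, ⟨_, hf.delay n⟩, fun i => ?_⟩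
  simp only [ATheory.delay]
  split_ifs with h
  · exact Near.refl _
  · have := (hf.near (i - 1)).symm
    rwa [show i - 1 + 1 = i by omega] at this

theorem near_getVert {x y : V} (w : G.Walk x y) (i : ℕ) :
    Near G (w.getVert i) (w.getVert (i + 1)) := by
  rcases Nat.lt_or_ge i w.length with h | h
  · exact Or.inr (w.adj_getVert_succ h)
  · rw [w.getVert_of_length_le h, w.getVert_of_length_le (by omega)]; exact Near.refl _

theorem isLoopSeq_getVert (w : G.Walk b b) : IsLoopSeq G b w.getVert w.length :=
  ⟨w.getVert_zero, near_getVert w, fun _ hi => w.getVert_of_length_le hi⟩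

/-- The class in the fundamental group of a closed walk. -/
def walkClass (w : G.Walk b b) : FundamentalGroup G b :=
  Quotient.mk (loopSetoid G b) ⟨w.length, Loop.ofSeq w.getVert (isLoopSeq_getVert w)⟩

theorem mk_eq_walkClass {n : ℕ} (Φ : Loop G b n) (w : G.Walk b b)
    (h : SeqHomotopic G b Φ.seq w.getVert) :
    (Quotient.mk (loopSetoid G b) ⟨n, Φ⟩ : FundamentalGroup G b) = walkClass w :=
  Quotient.sound ((sHomotopic_iff _ _).2 (by rwa [Loop.seq_ofSeq]))

theorem walkClass_eq {w w' : G.Walk b b} (h : SeqHomotopic G b w.getVert w'.getVert) :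
    walkClass w = walkClass w' :=
  mk_eq_walkClass _ _ (by rwa [Loop.seq_ofSeq])

theorem getVert_append_eq_cat {x y z : V} (p : G.Walk x y) (q : G.Walk y z) :
    (p.append q).getVert = cat p.length p.getVert q.getVert := by
  funext i
  rw [Walk.getVert_append, cat]
  rcases lt_trichotomy i p.length with h | h | h
  · rw [if_pos h, if_pos h.le]
  · rw [if_neg (by omega), if_pos (by omega), h]; simp
  · rw [if_neg (by omega), if_neg (by omega)]

theorem walkClass_append (w w' : G.Walk b b) :
    walkClass (w.append w') = walkClass w * walkClass w' := by
  refine (mk_eq_walkClass (Loop.concat _ _) _ ?_).symm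
  rw [Loop.seq_concat, Loop.seq_ofSeq, Loop.seq_ofSeq, getVert_append_eq_cat]
  exact Relation.ReflTransGen.refl

theorem walkClass_reverse (w : G.Walk b b) : walkClass w.reverse = (walkClass w)⁻¹ := by
  refine (mk_eq_walkClass (Loop.inverse _) _ ?_).symm
  have : (Loop.ofSeq w.getVert (isLoopSeq_getVert w)).inverse.seq = w.reverse.getVert := by
    funext i; rw [Loop.seq_inverse, Loop.seq_ofSeq, Walk.getVert_reverse]
  rw [this]
  exact Relation.ReflTransGen.refl

/-! ### Exchanging short walks inside a loop -/

/-- The sequence that runs through `p`, then visits `m`, then runs through `q`. -/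
def via {x z : V} (p : G.Walk b x) (m : V) (q : G.Walk z b) (i : ℕ) : V :=
  if i ≤ p.length then p.getVert i else if i = p.length + 1 then m else q.getVert (i - p.length - 2)

section Via

variable {x z m m' : V} (p : G.Walk b x) (q : G.Walk z b)

theorem isLoopSeq_via (h₁ : Near G x m) (h₂ : Near G m z) :
    IsLoopSeq G b (via p m q) (p.length + 2 + q.length) where
  zero := by simp [via]
  near i := by
    simp only [via]
    rcases lt_trichotomy i p.length with h | rfl | h
    · rw [if_pos h.le, if_pos (Nat.succ_le_of_lt h)]; exact near_getVert p i
    · simpa using h₁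
    · rw [if_neg (by omega), if_neg (by omega : ¬ i + 1 ≤ p.length),
        if_neg (by omega : ¬ i + 1 = p.length + 1)]
      by_cases h' : i = p.length + 1
      · subst h'
        rw [if_pos rfl, show p.length + 1 + 1 - p.length - 2 = 0 by omega, q.getVert_zero]
        exact h₂
      · rw [if_neg h']
        have := near_getVert q (i - p.length - 2)
        rwa [show i - p.length - 2 + 1 = i + 1 - p.length - 2 by omega] at this
  stable i hi := by
    rw [via, if_neg (by omega), if_neg (by omega), q.getVert_of_length_le (by omega)]

/-- The vertices `m` and `m'` need not be near each other, so the two sequences are first shifted in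
time. One pauses at `z` after the detour, the other at `x` before it. The rows `x, m, z, z` and `x,
x, m', z` are then near at every time. -/
theorem via_homotopic (h₁ : Near G x m) (h₂ : Near G m z) (h₁' : Near G x m')
    (h₂' : Near G m' z) : SeqHomotopic G b (via p m q) (via p m' q) := by
  have h := isLoopSeq_via p q h₁ h₂
  have h' := isLoopSeq_via p q h₁' h₂'
  refine ((h.homotopic_delay (p.length + 2)).tail
    ⟨⟨_, h.delay _⟩, ⟨_, h'.delay p.length⟩, fun i => ?_⟩).trans
    (h'.homotopic_delay p.length).symm
  simp only [delay]
  by_cases hi : i ≤ p.length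
  · rw [if_pos (by omega), if_pos hi]; simp only [via, if_pos hi]; exact Near.refl _
  rw [if_neg hi]
  by_cases hi1 : i = p.length + 1
  · subst hi1; simpa [via] using h₁.symm
  by_cases hi2 : i = p.length + 2
  · subst hi2; simpa [via] using h₂'.symm
  rw [if_neg (by omega)]
  simp only [via]
  rw [if_neg (by omega), if_neg (by omega), if_neg (by omega), if_neg (by omega)]
  exact Near.refl _

/-- Pauses stretch the short walk until it takes exactly two time steps: two pauses for length zero,
one for length one, none for length two. -/
theorem exists_via_homotopic (s : G.Walk x z) (hs : s.length ≤ 2) :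
    ∃ m, Near G x m ∧ Near G m z ∧
      SeqHomotopic G b (p.append (s.append q)).getVert (via p m q) := by
  have hl := isLoopSeq_getVert (p.append (s.append q))
  rcases s with _ | ⟨h, _ | ⟨h', _ | ⟨h'', s⟩⟩⟩
  · refine ⟨x, Near.refl _, Near.refl _, ?_⟩
    refine (hl.homotopic_delay p.length).trans ?_
    convert (hl.delay p.length).homotopic_delay p.length using 1
    funext i
    simp only [via, delay, Walk.nil_append, getVert_append_eq_cat, cat]
    by_cases hi : i ≤ p.length
    · simp only [if_pos hi]
    by_cases hi1 : i = p.length + 1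
    · subst hi1; simp
    by_cases hi2 : i = p.length + 2
    · subst hi2; simp
    simp only [if_neg hi, if_neg hi1]
    rw [if_neg (by omega), if_neg (by omega)]
    congr 1; omega
  · refine ⟨x, Near.refl _, Or.inr h, ?_⟩
    convert hl.homotopic_delay p.length using 1
    funext i
    simp only [via, delay, getVert_append_eq_cat, cat,
      Walk.cons_append, Walk.nil_append]
    by_cases hi : i ≤ p.length
    · simp only [if_pos hi]
    by_cases hi1 : i = p.length + 1
    · subst hi1; simp
    simp only [if_neg hi, if_neg hi1]
    rw [if_neg (by omega), show i - 1 - p.length = i - p.length - 2 + 1 by omega,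
      Walk.getVert_cons_succ]
  · refine ⟨_, Or.inr h, Or.inr h', ?_⟩
    refine Eq.subst (motive := SeqHomotopic G b _) ?_ Relation.ReflTransGen.refl
    funext i
    simp only [via, getVert_append_eq_cat, cat, Walk.cons_append, Walk.nil_append]
    by_cases hi : i ≤ p.length
    · simp only [if_pos hi]
    by_cases hi1 : i = p.length + 1
    · subst hi1; simp
    simp only [if_neg hi, if_neg hi1]
    rw [show i - p.length = i - p.length - 2 + 1 + 1 by omega,
      Walk.getVert_cons_succ, Walk.getVert_cons_succ]
    congr 1
  · simp only [Walk.length_cons] at hs; omega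

/-- Walks of length at most two with the same endpoints may be exchanged inside a loop. -/
theorem walkClass_eq_of_short {s s' : G.Walk x z} (hs : s.length ≤ 2) (hs' : s'.length ≤ 2) :
    walkClass (p.append (s.append q)) = walkClass (p.append (s'.append q)) := by
  obtain ⟨m, h₁, h₂, h⟩ := exists_via_homotopic p q s hs
  obtain ⟨m', h₁', h₂', h'⟩ := exists_via_homotopic p q s' hs'
  exact walkClass_eq (h.trans ((via_homotopic p q h₁ h₂ h₁' h₂').trans h'.symm))

end Via

/-- Each backtrack along an edge is a walk of length two from a vertex to itself, hence exchangeable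
with the empty walk. -/
theorem walkClass_cancel {x y : V} (p : G.Walk b y) (r : G.Walk x y) (q : G.Walk y b) :
    walkClass (p.append (r.reverse.append (r.append q))) = walkClass (p.append q) := by
  induction r with
  | nil => rfl
  | cons h r ih =>
    rw [← ih p q]
    have := walkClass_eq_of_short (p.append r.reverse) (r.append q)
      (s := Walk.cons h.symm (Walk.cons h Walk.nil)) (s' := Walk.nil) (by simp) (by simp)
    simpa [Walk.reverse_cons, ← Walk.append_assoc, Walk.concat_eq_append] using this

/-- A loop may pause, a walk may not. The induction on `k` replaces the first `k` steps of the loop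
by a walk without pauses and leaves the rest as it is. -/
theorem exists_walkClass_eq (a : FundamentalGroup G b) : ∃ w : G.Walk b b, walkClass w = a := by
  obtain ⟨⟨n, Φ⟩, rfl⟩ := Quotient.exists_rep a
  have hf := Φ.isLoopSeq
  have key : ∀ k, ∃ w : G.Walk b (Φ.seq k),
      SeqHomotopic G b Φ.seq (cat w.length w.getVert fun j => Φ.seq (k + j)) := by
    intro k
    induction k with
    | zero =>
      have e : cat (Walk.nil.copy rfl hf.zero.symm : G.Walk b (Φ.seq 0)).length
          (Walk.nil.copy rfl hf.zero.symm : G.Walk b (Φ.seq 0)).getVert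
          (fun j => Φ.seq (0 + j)) = Φ.seq := by
        funext i
        simp only [cat, Walk.length_copy, Walk.length_nil, zero_add, Nat.sub_zero]
        split_ifs with h
        · obtain rfl : i = 0 := by omega
          simp [hf.zero]
        · rfl
      exact ⟨Walk.nil.copy rfl hf.zero.symm, by rw [e]; exact Relation.ReflTransGen.refl⟩
    | succ k ih =>
      obtain ⟨w, hw⟩ := ih
      rcases hf.near k with h | h
      · refine ⟨w.copy rfl h, ?_⟩
        have hM : IsLoopSeq G b (cat (w.copy rfl h).length (w.copy rfl h).getVert
            fun j => Φ.seq (k + 1 + j)) (w.length + n) := by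
          refine ⟨by simp [cat], fun i => ?_, fun i hi => ?_⟩
          · simp only [cat, Walk.length_copy, Walk.getVert_copy]
            rcases lt_trichotomy i w.length with h1 | h1 | h1
            · rw [if_pos h1.le, if_pos (Nat.succ_le_of_lt h1)]; exact near_getVert w i
            · rw [if_pos h1.le, if_neg (by omega), h1, w.getVert_length,
                show k + 1 + (w.length + 1 - w.length) = k + 1 + 1 by omega]
              exact h.symm ▸ hf.near (k + 1)
            · rw [if_neg (by omega), if_neg (by omega)]
              rw [show k + 1 + (i + 1 - w.length) = k + 1 + (i - w.length) + 1 by omega]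
              exact hf.near _
          · simp only [cat, Walk.length_copy, Walk.getVert_copy]
            split_ifs with h1
            · obtain rfl : i = w.length := by omega
              rw [w.getVert_length]; exact hf.stable _ (by omega)
            · exact hf.stable _ (by omega)
        refine hw.trans ?_
        -- The loop pauses at time `k`, so the sequence before removal of this pause is the new one
        -- delayed at the end of `w`.
        convert (hM.homotopic_delay w.length).symm using 1
        funext i
        simp only [cat, delay, Walk.length_copy, Walk.getVert_copy]
        by_cases h1 : i ≤ w.length
        · simp only [if_pos h1]
        simp only [if_neg h1]
        by_cases h2 : i = w.length + 1
        · subst h2; simp [h]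
        rw [if_neg (by omega)]
        congr 1; omega
      · have e : cat (w.concat h).length (w.concat h).getVert (fun j => Φ.seq (k + 1 + j)) =
            cat w.length w.getVert (fun j => Φ.seq (k + j)) := by
          funext i
          simp only [Walk.concat_eq_append, getVert_append_eq_cat, cat, Walk.length_append,
            Walk.length_cons, Walk.length_nil]
          by_cases h1 : i ≤ w.length
          · rw [if_pos (by omega), if_pos h1, if_pos h1]
          by_cases h2 : i = w.length + 1
          · subst h2; simp
          rw [if_neg (by omega), if_neg h1]
          congr 1; omega
        exact ⟨w.concat h, by rwa [e]⟩
  obtain ⟨w, hw⟩ := key n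
  have hb := hf.stable n le_rfl
  refine ⟨w.copy rfl hb, (mk_eq_walkClass Φ _ ?_).symm⟩
  -- From time `n` on the loop is constantly `b`, as is `getVert` beyond the length of the walk.
  convert hw using 1
  funext i
  simp only [Walk.getVert_copy, cat]
  split_ifs with h
  · rfl
  · exact (w.getVert_of_length_le (by omega)).trans (hb.trans (hf.stable _ (by omega)).symm)

end Walks

end ATheory
namespace PathHomology

open SimpleGraph ATheory

/-! ### Regularized chains and boundaries in low degrees -/

section Chains

universe u

variable {V : Type u}

/-- A vertex as a chain of degree zero. -/
noncomputable def vertex (x : V) : Chain V 0 := Finsupp.single ![x] 1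

open scoped Classical in
/-- The regularization of the elementary path `x y`. -/
noncomputable def edge (x y : V) : Chain V 1 := if x = y then 0 else Finsupp.single ![x, y] 1

open scoped Classical in
/-- The regularization of the elementary path `x y z`. -/
noncomputable def triangle (x y z : V) : Chain V 2 :=
  if x = y ∨ y = z then 0 else Finsupp.single ![x, y, z] 1

@[simp]
theorem edge_self (x : V) : edge x x = 0 := by simp [edge]

theorem edge_of_ne {x y : V} (h : x ≠ y) : edge x y = Finsupp.single ![x, y] 1 := by
  simp [edge, h]

theorem regularize_zero_single (i : Fin 1 → V) (c : ℤ) :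
    regularize V 0 (Finsupp.single i c) = Finsupp.single i c := by
  have : IsRegular i := fun k => k.elim0
  simp [regularize, this]

theorem regularize_one_single (x y : V) (c : ℤ) :
    regularize V 1 (Finsupp.single ![x, y] c) = c • edge x y := by
  have : IsRegular ![x, y] ↔ x ≠ y := by simp [IsRegular, Fin.forall_fin_one]
  by_cases h : x = y
  · subst h; simp [regularize, this]
  · simp [regularize, this, h, edge]

theorem regBoundary_single_pair (x y : V) :
    regBoundary V 0 (Finsupp.single ![x, y] 1) = vertex y - vertex x := by
  have h0 : (fun k : Fin 1 => ![x, y] ((0 : Fin 2).succAbove k)) = ![y] := by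
    funext k; fin_cases k; rfl
  have h1 : (fun k : Fin 1 => ![x, y] ((1 : Fin 2).succAbove k)) = ![x] := by
    funext k; fin_cases k; rfl
  have e : boundary V 0 (Finsupp.single ![x, y] 1) = ∑ q : Fin 2,
      Finsupp.single (fun k : Fin 1 => ![x, y] (q.succAbove k)) ((-1 : ℤ) ^ (q : ℕ)) := by
    rw [boundary, Finsupp.linearCombination_single, one_smul]
  rw [regBoundary, LinearMap.comp_apply, e, Fin.sum_univ_two, h0, h1, map_add,
    regularize_zero_single, regularize_zero_single]
  simp [sub_eq_add_neg, vertex]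

theorem regBoundary_edge (x y : V) : regBoundary V 0 (edge x y) = vertex y - vertex x := by
  by_cases h : x = y
  · simp [h]
  · rw [edge_of_ne h, regBoundary_single_pair]

theorem regBoundary_single_triple (x y z : V) :
    regBoundary V 1 (Finsupp.single ![x, y, z] 1) = edge y z - edge x z + edge x y := by
  have h0 : (fun k : Fin 2 => ![x, y, z] ((0 : Fin 3).succAbove k)) = ![y, z] := by
    funext k; fin_cases k <;> rfl
  have h1 : (fun k : Fin 2 => ![x, y, z] ((1 : Fin 3).succAbove k)) = ![x, z] := by
    funext k; fin_cases k <;> rfl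
  have h2 : (fun k : Fin 2 => ![x, y, z] ((2 : Fin 3).succAbove k)) = ![x, y] := by
    funext k; fin_cases k <;> rfl
  have e : boundary V 1 (Finsupp.single ![x, y, z] 1) = ∑ q : Fin 3,
      Finsupp.single (fun k : Fin 2 => ![x, y, z] (q.succAbove k)) ((-1 : ℤ) ^ (q : ℕ)) := by
    rw [boundary, Finsupp.linearCombination_single, one_smul]
  rw [regBoundary, LinearMap.comp_apply, e, Fin.sum_univ_three, h0, h1, h2, map_add, map_add,
    regularize_one_single, regularize_one_single, regularize_one_single]
  simp [sub_eq_add_neg]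

/-- For a degenerate triangle two of the edges cancel and the third is zero, so pauses need no
separate treatment below. -/
theorem regBoundary_triangle (x y z : V) :
    regBoundary V 1 (triangle x y z) = edge y z - edge x z + edge x y := by
  unfold triangle
  split_ifs with h
  · rcases h with rfl | rfl <;> simp
  · exact regBoundary_single_triple x y z

end Chains

section Graph

universe u

variable {V : Type u} {G : SimpleGraph V} {b : V}

theorem mem_allowed_zero (c : Chain V 0) : c ∈ allowed (doubleDigraph G) 0 := by
  induction c using Finsupp.induction_linear with
  | zero => exact zero_mem _
  | add c d hc hd => exact add_mem hc hd
  | single i n =>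
    rw [show Finsupp.single i n = n • Finsupp.single i (1 : ℤ) by simp]
    exact Submodule.smul_mem _ _ (Submodule.subset_span ⟨i, fun k => k.elim0, rfl⟩)

theorem mem_cycles_one {c : Chain V 1} :
    c ∈ cycles (doubleDigraph G) 1 ↔
      c ∈ allowed (doubleDigraph G) 1 ∧ regBoundary V 0 c = 0 := by
  change (c ∈ allowed _ 1 ∧ _ ∈ allowed _ 0) ∧ c ∈ LinearMap.ker (regBoundary V 0) ↔ _
  simp [mem_allowed_zero]

theorem edge_mem_allowed {x y : V} (h : Near G x y) :
    edge x y ∈ allowed (doubleDigraph G) 1 := by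
  rcases h with rfl | h
  · simp
  · rw [edge_of_ne h.ne]
    refine Submodule.subset_span ⟨_, fun k => ?_, rfl⟩
    fin_cases k; exact h

theorem triangle_mem_allowed {x y z : V} (h : Near G x y) (h' : Near G y z) :
    triangle x y z ∈ allowed (doubleDigraph G) 2 := by
  unfold triangle
  split_ifs with hn
  · exact zero_mem _
  · push Not at hn
    refine Submodule.subset_span ⟨_, fun k => ?_, rfl⟩
    fin_cases k
    · exact h.resolve_left hn.1
    · exact h'.resolve_left hn.2

/-! ### Squares as boundaries -/

theorem regBoundary_mem_boundaries {c : Chain V 2} (h : c ∈ allowed (doubleDigraph G) 2)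
    (h' : regBoundary V 1 c ∈ allowed (doubleDigraph G) 1) :
    regBoundary V 1 c ∈ boundaries (doubleDigraph G) 1 :=
  Submodule.mem_map_of_mem (p := invariant (doubleDigraph G) 2) ⟨h, h'⟩

/-- The diagonal `edge x w` need not be allowed, so neither triangle need be invariant on its own;
it cancels in their difference. -/
theorem square_mem_boundaries {x y z w : V} (hxy : Near G x y) (hyw : Near G y w)
    (hxz : Near G x z) (hzw : Near G z w) :
    edge x y + edge y w - edge x z - edge z w ∈ boundaries (doubleDigraph G) 1 := by
  have e : edge x y + edge y w - edge x z - edge z w =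
      regBoundary V 1 (triangle x y w - triangle x z w) := by
    rw [map_sub, regBoundary_triangle, regBoundary_triangle]; abel
  have h : edge x y + edge y w - edge x z - edge z w ∈ allowed (doubleDigraph G) 1 :=
    sub_mem (sub_mem (add_mem (edge_mem_allowed hxy) (edge_mem_allowed hyw))
      (edge_mem_allowed hxz)) (edge_mem_allowed hzw)
  rw [e] at h ⊢
  exact regBoundary_mem_boundaries
    (sub_mem (triangle_mem_allowed hxy hyw) (triangle_mem_allowed hxz hzw)) h

theorem edge_add_edge_swap_mem_boundaries {x y : V} (h : Near G x y) :
    edge x y + edge y x ∈ boundaries (doubleDigraph G) 1 := by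
  simpa using square_mem_boundaries h h.symm (Near.refl x) (Near.refl x)

/-! ### From loops to homology classes -/

/-- The sum of the first `n` edges of a sequence. -/
noncomputable def seqChain (f : ℕ → V) (n : ℕ) : Chain V 1 :=
  ∑ i ∈ Finset.range n, edge (f i) (f (i + 1))

theorem seqChain_succ (f : ℕ → V) (n : ℕ) :
    seqChain f (n + 1) = seqChain f n + edge (f n) (f (n + 1)) :=
  Finset.sum_range_succ _ _

theorem seqChain_add (f : ℕ → V) (n m : ℕ) :
    seqChain f (n + m) = seqChain f n + seqChain (fun i => f (n + i)) m :=
  Finset.sum_range_add _ _ _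

theorem seqChain_congr {f g : ℕ → V} {n : ℕ} (h : ∀ i ≤ n, f i = g i) :
    seqChain f n = seqChain g n := by
  refine Finset.sum_congr rfl fun i hi => ?_
  have := Finset.mem_range.1 hi
  rw [h i (by omega), h (i + 1) (by omega)]

theorem seqChain_const (x : V) (n : ℕ) : seqChain (fun _ => x) n = 0 :=
  Finset.sum_eq_zero fun _ _ => edge_self x

theorem seqChain_eq_of_le {f : ℕ → V} {n m : ℕ} (hf : IsLoopSeq G b f n) (h : n ≤ m) :
    seqChain f m = seqChain f n := by
  obtain ⟨k, rfl⟩ := Nat.exists_eq_add_of_le h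
  have e : seqChain (fun i => f (n + i)) k = seqChain (fun _ => b) k :=
    seqChain_congr fun i _ => hf.stable _ (by omega)
  rw [seqChain_add, e, seqChain_const, add_zero]

theorem seqChain_mem_cycles {f : ℕ → V} {n : ℕ} (hf : IsLoopSeq G b f n) :
    seqChain f n ∈ cycles (doubleDigraph G) 1 := by
  refine mem_cycles_one.2 ⟨sum_mem fun i _ => edge_mem_allowed (hf.near i), ?_⟩
  simp only [seqChain, map_sum, regBoundary_edge]
  rw [Finset.sum_range_sub fun i => vertex (f i), hf.zero, hf.stable n le_rfl, sub_self]

/-- The two sequences bound a ladder of squares. Its first `k` squares leave the rung `edge (f k) (g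
k)` as a correction, which vanishes once both sequences have settled at `b`. -/
theorem seqChain_sub_mem_of_step {f g : ℕ → V} {n m : ℕ} (hf : IsLoopSeq G b f n)
    (hg : IsLoopSeq G b g m) (h : ∀ i, Near G (f i) (g i)) :
    seqChain f n - seqChain g m ∈ boundaries (doubleDigraph G) 1 := by
  have key : ∀ k, seqChain f k + edge (f k) (g k) - seqChain g k
      ∈ boundaries (doubleDigraph G) 1 := by
    intro k
    induction k with
    | zero => simp [seqChain, hf.zero, hg.zero]
    | succ k ih =>
      convert add_mem ih (square_mem_boundaries (hf.near k) (h (k + 1)) (h k) (hg.near k)) using 1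
      rw [seqChain_succ, seqChain_succ]; abel
  have := key (max n m)
  rwa [hf.stable _ (le_max_left _ _), hg.stable _ (le_max_right _ _), edge_self, add_zero,
    seqChain_eq_of_le hf (le_max_left _ _), seqChain_eq_of_le hg (le_max_right _ _)] at this

theorem seqChain_sub_mem_of_seqHomotopic {f g : ℕ → V} {n m : ℕ} (hf : IsLoopSeq G b f n)
    (hg : IsLoopSeq G b g m) (h : SeqHomotopic G b f g) :
    seqChain f n - seqChain g m ∈ boundaries (doubleDigraph G) 1 := by
  induction h generalizing m with
  | refl => exact seqChain_sub_mem_of_step hf hg fun _ => Near.refl _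
  | tail _ hs ih =>
    obtain ⟨k, hk⟩ := hs.left
    convert add_mem (ih hk) (seqChain_sub_mem_of_step hk hg hs.near) using 1
    abel

theorem seqChain_cat {f g : ℕ → V} {n : ℕ} (h : g 0 = f n) (m : ℕ) :
    seqChain (cat n f g) (n + m) = seqChain f n + seqChain g m := by
  rw [seqChain_add]
  congr 1
  · exact seqChain_congr fun i hi => if_pos hi
  · refine seqChain_congr fun i _ => ?_
    simp only [cat]
    split_ifs with hi
    · obtain rfl : i = 0 := by omega
      exact h.symm
    · congr 1; omega

/-- The homology class of a loop. -/
noncomputable def loopClass {n : ℕ} (Φ : Loop G b n) : graphHomology G 1 :=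
  Submodule.Quotient.mk ⟨seqChain Φ.seq n, seqChain_mem_cycles Φ.isLoopSeq⟩

theorem loopClass_eq {n m : ℕ} {Φ : Loop G b n} {Ψ : Loop G b m} (h : SHomotopic Φ Ψ) :
    loopClass Φ = loopClass Ψ :=
  (Submodule.Quotient.eq _).2 <|
    seqChain_sub_mem_of_seqHomotopic Φ.isLoopSeq Ψ.isLoopSeq ((sHomotopic_iff _ _).1 h)

theorem loopClass_concat {n m : ℕ} (Φ : Loop G b n) (Ψ : Loop G b m) :
    loopClass (Φ.concat Ψ) = loopClass Φ + loopClass Ψ := by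
  refine congrArg Submodule.Quotient.mk (Subtype.ext ?_)
  change seqChain (Φ.concat Ψ).seq (n + m) = seqChain Φ.seq n + seqChain Ψ.seq m
  rw [Loop.seq_concat, seqChain_cat]
  rw [Ψ.isLoopSeq.zero, Φ.isLoopSeq.stable n le_rfl]

/-- The Hurewicz homomorphism. -/
noncomputable def hurewicz (G : SimpleGraph V) (b : V) :
    FundamentalGroup G b →* Multiplicative (graphHomology G 1) :=
  MonoidHom.mk' (Quotient.lift (fun Φ => Multiplicative.ofAdd (loopClass Φ.2))
    fun _ _ h => congrArg Multiplicative.ofAdd (loopClass_eq h)) (by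
      rintro ⟨Φ⟩ ⟨Ψ⟩
      exact congrArg Multiplicative.ofAdd (loopClass_concat Φ.2 Ψ.2))

/-- The sum of the edges of a walk. -/
noncomputable def walkChain : {x y : V} → G.Walk x y → Chain V 1
  | _, _, .nil => 0
  | x, _, .cons (v := y) _ w => edge x y + walkChain w

theorem seqChain_getVert {x y : V} (w : G.Walk x y) :
    seqChain w.getVert w.length = walkChain w := by
  induction w with
  | nil => rfl
  | cons h w ih =>
    rw [walkChain, ← ih, Walk.length_cons, seqChain, Finset.sum_range_succ', add_comm]
    simp [seqChain, Walk.getVert_cons_succ]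

theorem walkChain_append {x y z : V} (p : G.Walk x y) (q : G.Walk y z) :
    walkChain (p.append q) = walkChain p + walkChain q := by
  induction p with
  | nil => simp [walkChain]
  | cons h p ih => rw [Walk.cons_append, walkChain, ih, walkChain, add_assoc]

/-- The two orientations of an edge are independent generators; their sum vanishes only modulo
boundaries, by a degenerate square. -/
theorem walkChain_add_reverse_mem_boundaries {x y : V} (p : G.Walk x y) :
    walkChain p + walkChain p.reverse ∈ boundaries (doubleDigraph G) 1 := by
  induction p with
  | nil => simp [walkChain]
  | cons h p ih =>
    convert add_mem ih (edge_add_edge_swap_mem_boundaries (Or.inr h)) using 1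
    rw [Walk.reverse_cons, walkChain_append, walkChain, walkChain, walkChain]
    abel

theorem walkChain_mem_cycles (w : G.Walk b b) : walkChain w ∈ cycles (doubleDigraph G) 1 := by
  rw [← seqChain_getVert]; exact seqChain_mem_cycles (isLoopSeq_getVert w)

theorem hurewicz_walkClass (w : G.Walk b b) :
    hurewicz G b (walkClass w) =
      Multiplicative.ofAdd (Submodule.Quotient.mk ⟨walkChain w, walkChain_mem_cycles w⟩) := by
  refine congrArg (fun c => Multiplicative.ofAdd (Submodule.Quotient.mk c)) (Subtype.ext ?_)
  change seqChain (Loop.ofSeq w.getVert (isLoopSeq_getVert w)).seq w.length = _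
  rw [Loop.seq_ofSeq, seqChain_getVert]

end Graph

end PathHomology
namespace PathHomology

open SimpleGraph ATheory

/-! ### The map back from chains to the abelianized group -/

section Inverse

universe u

variable {V : Type u} {G : SimpleGraph V} (hG : G.Connected) (b : V)

/-- The loop class of a walk whose endpoints are joined to the base vertex by chosen walks. -/
noncomputable def closedClass {x y : V} (w : G.Walk x y) : FundamentalGroup G b :=
  walkClass ((hG b x).some.append (w.append (hG b y).some.reverse))

/-- In the product, the return from `y` to the base and the second departure to `y` cancel. -/
theorem closedClass_append {x y z : V} (p : G.Walk x y) (q : G.Walk y z) :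
    closedClass hG b (p.append q) = closedClass hG b p * closedClass hG b q := by
  have := walkClass_cancel ((hG b x).some.append p) (hG b y).some
    (q.append (hG b z).some.reverse)
  simp only [closedClass, ← walkClass_append, ← Walk.append_assoc] at this ⊢
  exact this.symm

/-- An idempotent of a group is trivial. -/
theorem closedClass_nil (x : V) : closedClass hG b (Walk.nil : G.Walk x x) = 1 := by
  simpa using closedClass_append hG b (Walk.nil : G.Walk x x) Walk.nil

/-- The chosen walk from `b` to itself need not be empty, so the two classes agree only up to
conjugation. -/
theorem abelianization_closedClass (w : G.Walk b b) :
    Abelianization.of (closedClass hG b w) = Abelianization.of (walkClass w) := by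
  rw [closedClass, walkClass_append, walkClass_append, walkClass_reverse]
  simp only [map_mul, map_inv]
  rw [mul_comm, mul_assoc, inv_mul_cancel, mul_one]

open scoped Classical in
/-- The class of any walk of length at most two between two vertices, and zero if there is none. -/
noncomputable def pairClass (x z : V) : Additive (Abelianization (FundamentalGroup G b)) :=
  if h : ∃ w : G.Walk x z, w.length ≤ 2 then
    Additive.ofMul (Abelianization.of (closedClass hG b h.choose)) else 0

/-- Independence of the choice is the exchange of short walks. Length two is allowed because
boundaries of triangles contain diagonals between possibly non-adjacent vertices. The default value
`0` occurs only for pairs that never arise. -/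
theorem pairClass_eq {x z : V} (w : G.Walk x z) (hw : w.length ≤ 2) :
    pairClass hG b x z = Additive.ofMul (Abelianization.of (closedClass hG b w)) := by
  have h : ∃ w : G.Walk x z, w.length ≤ 2 := ⟨w, hw⟩
  rw [pairClass, dif_pos h, closedClass, closedClass, walkClass_eq_of_short _ _ h.choose_spec hw]

/-- The linear extension of `pairClass` to chains of degree one. -/
noncomputable def chainClass :
    Chain V 1 →ₗ[ℤ] Additive (Abelianization (FundamentalGroup G b)) :=
  Finsupp.linearCombination ℤ fun i => pairClass hG b (i 0) (i 1)

theorem chainClass_edge {x z : V} (w : G.Walk x z) (hw : w.length ≤ 2) :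
    chainClass hG b (edge x z) = Additive.ofMul (Abelianization.of (closedClass hG b w)) := by
  by_cases h : x = z
  · subst h
    rw [← pairClass_eq hG b w hw, pairClass_eq hG b Walk.nil (by simp), closedClass_nil]
    simp
  · rw [edge_of_ne h, chainClass, Finsupp.linearCombination_single, one_smul]
    exact pairClass_eq hG b w hw

theorem chainClass_walkChain {x y : V} (w : G.Walk x y) :
    chainClass hG b (walkChain w) =
      Additive.ofMul (Abelianization.of (closedClass hG b w)) := by
  induction w with
  | nil => simp [walkChain, closedClass_nil]
  | cons h w ih =>
    rw [walkChain, map_add, ih, chainClass_edge hG b (Walk.cons h Walk.nil) (by simp),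
      ← ofMul_mul, ← map_mul, ← closedClass_append, Walk.cons_append, Walk.nil_append]

/-- Invariance of `c` plays no role: the class of the diagonal is computed along the two sides, so
every allowed triangle contributes zero by itself. -/
theorem chainClass_regBoundary {c : Chain V 2} (hc : c ∈ allowed (doubleDigraph G) 2) :
    chainClass hG b (regBoundary V 1 c) = 0 := by
  induction hc using Submodule.span_induction with
  | zero => simp
  | add c d _ _ hc hd => rw [map_add, map_add, hc, hd, add_zero]
  | smul n c _ hc => rw [map_smul, map_smul, hc, smul_zero]
  | mem c hc =>
    obtain ⟨i, hi, rfl⟩ := hc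
    have h₁ : G.Adj (i 0) (i 1) := hi 0
    have h₂ : G.Adj (i 1) (i 2) := hi 1
    have e : i = ![i 0, i 1, i 2] := by funext k; fin_cases k <;> rfl
    rw [e, regBoundary_single_triple, map_add, map_sub,
      chainClass_edge hG b (Walk.cons h₁ Walk.nil) (by simp),
      chainClass_edge hG b (Walk.cons h₂ Walk.nil) (by simp),
      chainClass_edge hG b ((Walk.cons h₁ Walk.nil).append (Walk.cons h₂ Walk.nil)) (by simp),
      closedClass_append, map_mul, ofMul_mul]
    abel

theorem chainClass_eq_zero {c : Chain V 1} (hc : c ∈ boundaries (doubleDigraph G) 1) :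
    chainClass hG b c = 0 := by
  obtain ⟨d, hd, rfl⟩ := hc
  exact chainClass_regBoundary hG b hd.1

/-! ### The Hurewicz map is bijective -/

/-- The homology classes embed into the chains modulo boundaries. -/
noncomputable def homologyToQuotient (G : SimpleGraph V) :
    graphHomology G 1 →ₗ[ℤ] Chain V 1 ⧸ boundaries (doubleDigraph G) 1 :=
  Submodule.mapQ _ _ (cycles (doubleDigraph G) 1).subtype le_rfl

/-- Single edges are not cycles. Working in all chains modulo boundaries lets an identity of
homology classes be checked edge by edge. -/
theorem homologyToQuotient_injective :
    Function.Injective (homologyToQuotient G) := by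
  rw [← LinearMap.ker_eq_bot, LinearMap.ker_eq_bot']
  intro a ha
  obtain ⟨c, rfl⟩ := Submodule.Quotient.mk_surjective _ a
  have h : (c : Chain V 1) ∈ boundaries (doubleDigraph G) 1 :=
    (Submodule.Quotient.mk_eq_zero _).1 ha
  exact (Submodule.Quotient.mk_eq_zero _).2 h

/-- The Hurewicz homomorphism on the abelianization, in additive notation. -/
noncomputable def abHurewicz (G : SimpleGraph V) (b : V) :
    Additive (Abelianization (FundamentalGroup G b)) →+ graphHomology G 1 :=
  (Abelianization.lift (hurewicz G b)).toAdditiveLeft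

theorem abHurewicz_walkClass (w : G.Walk b b) :
    abHurewicz G b (Additive.ofMul (Abelianization.of (walkClass w))) =
      Submodule.Quotient.mk ⟨walkChain w, walkChain_mem_cycles w⟩ := by
  change Multiplicative.toAdd (Abelianization.lift (hurewicz G b) (Abelianization.of _)) = _
  rw [Abelianization.lift_apply_of, hurewicz_walkClass]
  rfl

/-- The cone sending a vertex to the chosen walk from the base vertex. -/
noncomputable def cone : Chain V 0 →ₗ[ℤ] Chain V 1 :=
  Finsupp.linearCombination ℤ fun i => walkChain (hG b (i 0)).some

theorem cone_vertex (x : V) : cone hG b (vertex x) = walkChain (hG b x).some := by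
  simp [cone, vertex]

/-- Both sides are additive, so an edge from `x` to `y` suffices. Its loop goes out to `x`, along
the edge and back from `y`, and the way back counts as minus the chosen walk to `y`. -/
theorem homologyToQuotient_chainClass {c : Chain V 1}
    (hc : c ∈ allowed (doubleDigraph G) 1) :
    homologyToQuotient G (abHurewicz G b (chainClass hG b c)) =
      Submodule.Quotient.mk (c - cone hG b (regBoundary V 0 c)) := by
  induction hc using Submodule.span_induction with
  | zero => simp
  | add c d _ _ hc hd =>
    simp only [map_add, hc, hd, ← Submodule.Quotient.mk_add]
    congr 1; abel
  | smul n c _ hc =>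
    simp only [map_smul, map_zsmul, hc, ← Submodule.Quotient.mk_smul, smul_sub]
  | mem c hc =>
    obtain ⟨i, hi, rfl⟩ := hc
    have h : G.Adj (i 0) (i 1) := hi 0
    have e : i = ![i 0, i 1] := by funext k; fin_cases k <;> rfl
    generalize i 0 = x at *
    generalize i 1 = y at *
    subst e
    rw [regBoundary_single_pair, ← edge_of_ne h.ne,
      chainClass_edge hG b (Walk.cons h Walk.nil) (by simp), closedClass, abHurewicz_walkClass,
      map_sub, cone_vertex, cone_vertex]
    refine (Submodule.Quotient.eq _).2 ?_
    -- The edge and the walk to `x` cancel; what remains is the walk to `y` plus its reverse.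
    convert walkChain_add_reverse_mem_boundaries (hG b y).some using 1
    change walkChain _ - _ = _
    simp only [walkChain_append, walkChain]
    abel

theorem abHurewicz_injective (hG : G.Connected) (b : V) : Function.Injective (abHurewicz G b) := by
  rw [injective_iff_map_eq_zero]
  intro a ha
  obtain ⟨g, rfl⟩ : ∃ g, Additive.ofMul (Abelianization.of g) = a :=
    QuotientGroup.mk_surjective a
  obtain ⟨w, rfl⟩ := exists_walkClass_eq g
  rw [abHurewicz_walkClass] at ha
  have hw : walkChain w ∈ boundaries (doubleDigraph G) 1 :=
    (Submodule.Quotient.mk_eq_zero ((boundaries (doubleDigraph G) 1).submoduleOf _)).1 ha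
  -- Applied to the chain of `w`, `chainClass` recovers the class of `w` in the abelianization,
  -- which must therefore vanish.
  have := chainClass_eq_zero hG b hw
  rwa [chainClass_walkChain, abelianization_closedClass] at this

theorem abHurewicz_surjective (hG : G.Connected) (b : V) : Function.Surjective (abHurewicz G b) := by
  intro a
  obtain ⟨⟨c, hc⟩, rfl⟩ := Submodule.Quotient.mk_surjective _ a
  obtain ⟨h₁, h₂⟩ := mem_cycles_one.1 hc
  refine ⟨chainClass hG b c, homologyToQuotient_injective ?_⟩
  rw [homologyToQuotient_chainClass hG b h₁, h₂, map_zero, sub_zero]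
  rfl

end Inverse

end PathHomology

theorem theorem6 {V : Type*} (G : SimpleGraph V) (hG : G.Connected) (b : V) :
    Nonempty (Abelianization (ATheory.FundamentalGroup G b) ≃*
      Multiplicative (PathHomology.graphHomology G 1)) :=
  ⟨AddEquiv.toMultiplicativeRight (AddEquiv.ofBijective (PathHomology.abHurewicz G b)
    ⟨PathHomology.abHurewicz_injective hG b, PathHomology.abHurewicz_surjective hG b⟩)⟩
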